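/- Let $n, m \ge 0$ be natural numbers, and let $G$ be the group with presentation $$G = \langle x, y \mid [x^n, y^m] = 1\rangle,$$ where $[a,b] = aba^{-1}b^{-1}$. Then $G$ is $\mathbb{Z}$-linear, that is, for some natural number $d$ there exists an injective group homomorphism $G \to GL_d(\mathbb{Z})$. -/

import Mathlib

open scoped commutatorElement

/-- A group `G` is `R`-linear if it has a faithful representation into the group `GL_d(R)` of
invertible `d × d` matrices over the commutative ring `R`, for some natural number `d`. -/
def IsLinearOver (R : Type*) [CommRing R] (G : Type*) [Group G] : Prop :=
  ∃ (d : ℕ) (ρ : G →* Matrix.GeneralLinearGroup (Fin d) R), Function.Injective ρ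

/-- The group `⟨x, y | [x ^ n, y ^ m] = 1⟩`, where `x` and `y` are the generators with index
`0` and `1`, and `[a, b] = a * b * a⁻¹ * b⁻¹`. -/
abbrev PowerCommutatorGroup (n m : ℕ) : Type :=
  PresentedGroup
    ({⁅(FreeGroup.of 0 : FreeGroup (Fin 2)) ^ n, (FreeGroup.of 1 : FreeGroup (Fin 2)) ^ m⁆} :
      Set (FreeGroup (Fin 2)))

/-! If `n` or `m` is zero, the relator is trivial, the group is free, and transvections of ℤ² play
ping-pong. Otherwise, moving the commuting powers `x ^ n` and `y ^ m` through words shows that every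
element is a product of their powers, or a power of one of them times a `ReducedWord`. By
`injective_of_pingPong` it suffices that an action detects nontrivial such forms on one vector.

For each generator `b` the lattice has a block: a function f on ℤ/N b and integers p, q. The t-th
power of generator `b` rotates its f, adds δ = f(0) - f(-t) to its q and 8δ to f(0) of the other
block, and moves the other block by p ↦ p + tq, f(0) ↦ f(0) + 20(2tp + t²q). If N b divides t, then
δ = 0 and only the other block moves, which gives the relation. Otherwise, if f(0) dominates block
`b`, then δ is large: q now dominates p there, and f(0) dominates the other block. A nontrivial
power of the other generator with exponent a multiple of its N turns this large q back into a large
f(0). -/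

/-- An element of the group generated by `u true` and `u false` that is written as a product of
powers of the two generators, without cancellation modulo the powers `u b ^ N b`, and that starts
with a power of `u b` whose exponent is not a multiple of `N b`. -/
inductive ReducedWord {G : Type*} [Group G] (u : Bool → G) (N : Bool → ℕ) : Bool → G → Prop
  | base {b : Bool} {i : ℤ} (l : ℤ) (hi : ¬ (N b : ℤ) ∣ i) :
      ReducedWord u N b (u b ^ i * u (!b) ^ ((N !b : ℤ) * l))
  | switch {b : Bool} {i : ℤ} {h : G} (hi : ¬ (N b : ℤ) ∣ i) (hh : ReducedWord u N (!b) h) :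
      ReducedWord u N b (u b ^ i * h)
  | step {b : Bool} {i l : ℤ} {h : G} (hi : ¬ (N b : ℤ) ∣ i) (hl : (N !b : ℤ) * l ≠ 0)
      (hh : ReducedWord u N b h) :
      ReducedWord u N b (u b ^ i * (u (!b) ^ ((N !b : ℤ) * l) * h))

/-- The elements of the form `u true ^ (N true * k) * u false ^ (N false * l)`, and the reduced
words multiplied on the left by a power of some `u b ^ N b`. -/
def IsWordForm {G : Type*} [Group G] (u : Bool → G) (N : Bool → ℕ) (g : G) : Prop :=
  (∃ k l : ℤ, g = u true ^ ((N true : ℤ) * k) * u false ^ ((N false : ℤ) * l)) ∨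
    ∃ (b : Bool) (l : ℤ) (h : G), ReducedWord u N b h ∧ g = u (!b) ^ ((N !b : ℤ) * l) * h

/-! ### Word forms and the ping-pong criterion. -/

section Words

variable {G : Type*} [Group G] {u : Bool → G} {N : Bool → ℕ}

theorem commute_zpow_mul (hc : Commute (u true ^ N true) (u false ^ N false)) (b : Bool)
    (k l : ℤ) : Commute (u b ^ ((N b : ℤ) * k)) (u (!b) ^ ((N !b : ℤ) * l)) := by
  simp only [zpow_mul, zpow_natCast]
  cases b
  · exact (hc.symm.zpow_left k).zpow_right l
  · exact (hc.zpow_left k).zpow_right l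

theorem isWordForm_base (hc : Commute (u true ^ N true) (u false ^ N false)) (b : Bool)
    (k l : ℤ) : IsWordForm u N (u b ^ ((N b : ℤ) * k) * u (!b) ^ ((N !b : ℤ) * l)) := by
  cases b
  · exact Or.inl ⟨l, k, (commute_zpow_mul hc false k l).eq⟩
  · exact Or.inl ⟨k, l, rfl⟩

theorem ReducedWord.isWordForm {b : Bool} {h : G} (hh : ReducedWord u N b h) :
    IsWordForm u N h :=
  Or.inr ⟨b, 0, h, hh, by simp⟩

theorem ReducedWord.isWordForm_mul {b : Bool} {h : G} (hh : ReducedWord u N (!b) h) (l : ℤ) :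
    IsWordForm u N (u b ^ ((N b : ℤ) * l) * h) :=
  Or.inr ⟨!b, l, h, hh, by simp⟩

theorem ReducedWord.zpow_dvd_mul {b : Bool} {h : G} (hh : ReducedWord u N b h) (k : ℤ) :
    ReducedWord u N b (u b ^ ((N b : ℤ) * k) * h) := by
  cases hh with
  | @base _ j l hj =>
    rw [← mul_assoc, ← zpow_add]
    exact .base l (by rwa [Int.dvd_add_right (Dvd.intro _ rfl)])
  | @switch _ j h hj hh =>
    rw [← mul_assoc, ← zpow_add]
    exact .switch (by rwa [Int.dvd_add_right (Dvd.intro _ rfl)]) hh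
  | @step _ j l h hj hl hh =>
    rw [← mul_assoc, ← zpow_add]
    exact .step (by rwa [Int.dvd_add_right (Dvd.intro _ rfl)]) hl hh

theorem ReducedWord.zpow_mul_isWordForm (hc : Commute (u true ^ N true) (u false ^ N false))
    {b : Bool} {h : G} (hh : ReducedWord u N b h) (i : ℤ) : IsWordForm u N (u b ^ i * h) := by
  cases hh with
  | @base _ j l hj =>
    rw [← mul_assoc, ← zpow_add]
    by_cases hd : (N b : ℤ) ∣ i + j
    · obtain ⟨k, hk⟩ := hd
      rw [hk]
      exact isWordForm_base hc b k l
    · exact (ReducedWord.base l hd).isWordForm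
  | @switch _ j h hj hh =>
    rw [← mul_assoc, ← zpow_add]
    by_cases hd : (N b : ℤ) ∣ i + j
    · obtain ⟨k, hk⟩ := hd
      rw [hk]
      exact hh.isWordForm_mul k
    · exact (ReducedWord.switch hd hh).isWordForm
  | @step _ j l h hj hl hh =>
    rw [← mul_assoc, ← zpow_add]
    by_cases hd : (N b : ℤ) ∣ i + j
    · obtain ⟨k, hk⟩ := hd
      rw [hk, ← mul_assoc, (commute_zpow_mul hc b k l).eq, mul_assoc]
      exact Or.inr ⟨b, l, _, hh.zpow_dvd_mul k, rfl⟩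
    · exact (ReducedWord.step hd hl hh).isWordForm

/-- Exponents divisible by `N b` commute past the leading power of the other generator and are
absorbed by a reduced word starting with `b`; any other exponent opens a new syllable or merges with
the first one. -/
theorem IsWordForm.zpow_mul (hc : Commute (u true ^ N true) (u false ^ N false)) {g : G}
    (hg : IsWordForm u N g) (b : Bool) (i : ℤ) : IsWordForm u N (u b ^ i * g) := by
  rcases hg with hg | ⟨c, l, h, hh, rfl⟩
  · obtain ⟨k, l, rfl⟩ : ∃ k l : ℤ, g = u b ^ ((N b : ℤ) * k) * u (!b) ^ ((N !b : ℤ) * l) := by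
      obtain ⟨k, l, rfl⟩ := hg
      cases b
      · exact ⟨l, k, (commute_zpow_mul hc true k l).eq⟩
      · exact ⟨k, l, rfl⟩
    rw [← mul_assoc, ← zpow_add]
    by_cases hd : (N b : ℤ) ∣ i + N b * k
    · obtain ⟨k', hk⟩ := hd
      rw [hk]
      exact isWordForm_base hc b k' l
    · exact (ReducedWord.base l hd).isWordForm
  · obtain rfl | rfl : b = c ∨ b = !c := by cases b <;> cases c <;> simp
    · by_cases hd : (N b : ℤ) ∣ i
      · obtain ⟨k, rfl⟩ := hd
        rw [← mul_assoc, (commute_zpow_mul hc b k l).eq, mul_assoc]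
        exact Or.inr ⟨b, l, _, hh.zpow_dvd_mul k, rfl⟩
      · by_cases hl : (N !b : ℤ) * l = 0
        · rw [hl, zpow_zero, one_mul]
          exact hh.zpow_mul_isWordForm hc i
        · exact (ReducedWord.step hd hl hh).isWordForm
    · rw [← mul_assoc, ← zpow_add]
      by_cases hd : (N !c : ℤ) ∣ i + N (!c) * l
      · obtain ⟨k, hk⟩ := hd
        rw [hk]
        exact Or.inr ⟨c, k, h, hh, rfl⟩
      · exact (ReducedWord.switch hd (by simpa using hh)).isWordForm

theorem isWordForm_of_closure_eq_top (hc : Commute (u true ^ N true) (u false ^ N false))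
    (hu : Subgroup.closure (Set.range u) = ⊤) (g : G) : IsWordForm u N g := by
  have hg : g ∈ Subgroup.closure (Set.range u) := hu ▸ Subgroup.mem_top g
  induction hg using Subgroup.closure_induction_left with
  | one => exact Or.inl ⟨0, 0, by simp⟩
  | mul_left x hx y _ hy =>
    obtain ⟨b, rfl⟩ := hx
    simpa using hy.zpow_mul hc b 1
  | inv_mul_cancel x hx y _ hy =>
    obtain ⟨b, rfl⟩ := hx
    simpa using hy.zpow_mul hc b (-1)

/-- The ping-pong lemma for a group generated by two elements certain powers of which commute. -/
theorem injective_of_pingPong {V : Type*} [AddCommGroup V] (φ : G →* (V ≃ₗ[ℤ] V))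
    (hc : Commute (u true ^ N true) (u false ^ N false))
    (hu : Subgroup.closure (Set.range u) = ⊤) (S : Bool → Set V) (v₀ : V)
    (hbase : ∀ b i l, ¬ (N b : ℤ) ∣ i →
      φ (u b ^ i) (φ (u (!b) ^ ((N !b : ℤ) * l)) v₀) ∈ S b)
    (hswitch : ∀ b i v, ¬ (N b : ℤ) ∣ i → v ∈ S (!b) → φ (u b ^ i) v ∈ S b)
    (hstep : ∀ b i l v, ¬ (N b : ℤ) ∣ i → (N !b : ℤ) * l ≠ 0 → v ∈ S b →
      φ (u b ^ i) (φ (u (!b) ^ ((N !b : ℤ) * l)) v) ∈ S b)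
    (hne : ∀ b l v, v ∈ S b → φ (u (!b) ^ ((N !b : ℤ) * l)) v ≠ v₀)
    (hfix : ∀ k l : ℤ, φ (u true ^ ((N true : ℤ) * k) * u false ^ ((N false : ℤ) * l)) v₀ = v₀ →
      (N true : ℤ) * k = 0 ∧ (N false : ℤ) * l = 0) :
    Function.Injective φ := by
  have key : ∀ b h, ReducedWord u N b h → φ h v₀ ∈ S b := by
    intro b h hh
    induction hh with
    | base l hi => simpa only [map_mul, LinearEquiv.mul_apply] using hbase _ _ l hi
    | switch hi _ ih => simpa only [map_mul, LinearEquiv.mul_apply] using hswitch _ _ _ hi ih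
    | step hi hl _ ih => simpa only [map_mul, LinearEquiv.mul_apply] using hstep _ _ _ _ hi hl ih
  rw [injective_iff_map_eq_one]
  intro g hg
  rcases isWordForm_of_closure_eq_top hc hu g with ⟨k, l, rfl⟩ | ⟨b, l, h, hh, rfl⟩
  · obtain ⟨h₁, h₂⟩ := hfix k l (by rw [hg]; rfl)
    rw [h₁, h₂, zpow_zero, zpow_zero, one_mul]
  · refine absurd ?_ (hne b l _ (key b h hh))
    rw [← LinearEquiv.mul_apply, ← map_mul, hg]
    rfl

end Words

theorem isLinearOver_of_injective {R G V : Type*} [CommRing R] [Nontrivial R] [Group G]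
    [AddCommGroup V] [Module R V] [Module.Free R V] [Module.Finite R V] (φ : G →* (V ≃ₗ[R] V))
    (hφ : Function.Injective φ) : IsLinearOver R G := by
  let e : (V ≃ₗ[R] V) ≃* Matrix.GeneralLinearGroup (Fin (Module.finrank R V)) R :=
    (LinearMap.GeneralLinearGroup.generalLinearEquiv R V).symm.trans
      (Units.mapEquiv (LinearMap.toMatrixAlgEquiv (Module.finBasis R V)).toMulEquiv)
  exact ⟨_, e.toMonoidHom.comp φ, e.injective.comp hφ⟩

/-! ### Generators and the universal property. -/

section Presentation

/-- The two generators of `⟨x, y | [x ^ n, y ^ m] = 1⟩`, indexed by `Bool`. -/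
def PowerCommutatorGroup.gen (n m : ℕ) (b : Bool) : PowerCommutatorGroup n m :=
  PresentedGroup.of (bif b then 0 else 1)

theorem PowerCommutatorGroup.closure_range_gen (n m : ℕ) :
    Subgroup.closure (Set.range (PowerCommutatorGroup.gen n m)) = ⊤ := by
  rw [eq_top_iff, ← PresentedGroup.closure_range_of, Subgroup.closure_le]
  rintro _ ⟨i, rfl⟩
  apply Subgroup.subset_closure
  fin_cases i
  · exact ⟨true, rfl⟩
  · exact ⟨false, rfl⟩

theorem PowerCommutatorGroup.commute_gen (n m : ℕ) :
    Commute (PowerCommutatorGroup.gen n m true ^ n) (PowerCommutatorGroup.gen n m false ^ m) := by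
  rw [← commutatorElement_eq_one_iff_commute]
  exact PresentedGroup.one_of_mem (Set.mem_singleton _)

/-- The homomorphism from `⟨x, y | [x ^ n, y ^ m] = 1⟩` given by the images of the generators. -/
def PowerCommutatorGroup.lift {n m : ℕ} {H : Type*} [Group H] (w : Bool → H)
    (hw : Commute (w true ^ n) (w false ^ m)) : PowerCommutatorGroup n m →* H :=
  PresentedGroup.toGroup (f := fun i => w (decide (i = 0))) (by
    rintro r rfl
    simpa [map_commutatorElement] using commutatorElement_eq_one_iff_commute.2 hw)

theorem PowerCommutatorGroup.lift_gen {n m : ℕ} {H : Type*} [Group H] (w : Bool → H)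
    (hw : Commute (w true ^ n) (w false ^ m)) (b : Bool) :
    PowerCommutatorGroup.lift w hw (PowerCommutatorGroup.gen n m b) = w b := by
  cases b <;> simp [PowerCommutatorGroup.lift, PowerCommutatorGroup.gen]

end Presentation

/-- A one-parameter family of linear maps, as a homomorphism into the linear automorphisms. -/
def linearEquivOfZ {V : Type*} [AddCommGroup V] (E : ℤ → V →ₗ[ℤ] V) (h0 : E 0 = LinearMap.id)
    (hadd : ∀ i j, E (i + j) = E i ∘ₗ E j) : Multiplicative ℤ →* (V ≃ₗ[ℤ] V) where
  toFun i := LinearEquiv.ofLinearMap (E i.toAdd) (E (-i.toAdd))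
    (by rw [← hadd, add_neg_cancel, h0]) (by rw [← hadd, neg_add_cancel, h0])
  map_one' := by
    ext v
    simp [h0]
  map_mul' i j := by
    ext v
    simp [hadd]

theorem linearEquivOfZ_ofAdd_one_zpow {V : Type*} [AddCommGroup V] (E : ℤ → V →ₗ[ℤ] V)
    (h0 : E 0 = LinearMap.id) (hadd : ∀ i j, E (i + j) = E i ∘ₗ E j) (i : ℤ) (v : V) :
    (linearEquivOfZ E h0 hadd (Multiplicative.ofAdd 1) ^ i) v = E i v := by
  rw [← map_zpow, ← ofAdd_zsmul, smul_eq_mul, mul_one]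
  rfl

/-! ### The free case. -/

section Free

/-- The transvection of `ℤ²` that adds `3 * i` times the other coordinate to coordinate `b`. -/
def transvectionPow (b : Bool) (i : ℤ) : (Bool → ℤ) →ₗ[ℤ] (Bool → ℤ) where
  toFun v c := if c = b then v c + 3 * i * v (!c) else v c
  map_add' v w := by
    ext c
    simp only [Pi.add_apply]
    split_ifs <;> ring
  map_smul' r v := by
    ext c
    simp only [Pi.smul_apply, smul_eq_mul, RingHom.id_apply]
    split_ifs <;> ring

theorem transvectionPow_zero (b : Bool) : transvectionPow b 0 = LinearMap.id := by
  ext v c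
  simp [transvectionPow]

theorem transvectionPow_add (b : Bool) (i j : ℤ) :
    transvectionPow b (i + j) = transvectionPow b i ∘ₗ transvectionPow b j := by
  refine LinearMap.ext fun v => funext fun c => ?_
  cases b <;> cases c <;> simp [transvectionPow] <;> ring

/-- The factor 3, rather than 2, lets the base vector (1, 1) enter the ping-pong sets: |1 - 2| = 1
would fail. -/
theorem abs_lt_abs_add_three_mul {i x y : ℤ} (hi : i ≠ 0) (h : |x| < |y| ∨ (x = 1 ∧ y = 1)) :
    |y| < |x + 3 * i * y| := by
  have h1 : 1 ≤ |i| := Int.one_le_abs hi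
  rcases h with h | ⟨rfl, rfl⟩
  · have h2 : |3 * i * y| ≤ |x + 3 * i * y| + |x| := by
      have := abs_sub (x + 3 * i * y) x
      rwa [add_sub_cancel_left] at this
    have h3 : |3 * i * y| = 3 * (|i| * |y|) := by
      rw [abs_mul, abs_mul, mul_assoc]
      norm_num
    have h4 : |y| ≤ |i| * |y| := le_mul_of_one_le_left (abs_nonneg y) h1
    have := abs_nonneg y
    linarith
  · grind

theorem isLinearOver_of_eq_zero {n m : ℕ} (h : n = 0 ∨ m = 0) :
    IsLinearOver ℤ (PowerCommutatorGroup n m) := by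
  let w : Bool → ((Bool → ℤ) ≃ₗ[ℤ] (Bool → ℤ)) := fun b =>
    linearEquivOfZ _ (transvectionPow_zero b) (transvectionPow_add b) (Multiplicative.ofAdd 1)
  have hw : Commute (w true ^ n) (w false ^ m) := by
    rcases h with rfl | rfl <;> simp
  let φ := PowerCommutatorGroup.lift w hw
  have hφ : ∀ b i v, φ (PowerCommutatorGroup.gen n m b ^ i) v = transvectionPow b i v := by
    intro b i v
    rw [map_zpow, PowerCommutatorGroup.lift_gen]
    exact linearEquivOfZ_ofAdd_one_zpow _ _ _ i v
  -- With both moduli 0, whatever `n` and `m` are, word forms are the usual reduced words of a free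
  -- group and the `hstep` condition is vacuous.
  refine isLinearOver_of_injective φ (injective_of_pingPong (N := fun _ => 0) φ (by simp)
    (PowerCommutatorGroup.closure_range_gen n m) (fun b => {v | |v (!b)| < |v b|}) 1 ?_ ?_ ?_ ?_ ?_)
  · intro b i l hi
    have hi : i ≠ 0 := by simpa using hi
    simp only [hφ, Set.mem_ofPred_eq]
    simpa [transvectionPow] using abs_lt_abs_add_three_mul (x := 1) (y := 1) hi (by simp)
  · intro b i v hi hv
    have hi : i ≠ 0 := by simpa using hi
    simp only [hφ, Set.mem_ofPred_eq, Bool.not_not] at hv ⊢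
    simpa [transvectionPow] using abs_lt_abs_add_three_mul hi (Or.inl hv)
  · intro b i l v _ hl
    simp at hl
  · intro b l v hv h
    have hv : |v (!b)| < |v b| := hv
    rw [hφ] at h
    have h1 : v = 1 := by simpa [transvectionPow_zero] using h
    simp [h1] at hv
  · simp

end Free

/-! ### The case of nonzero exponents: the action. -/

section Finite

variable (N : Bool → ℕ)

/-- The free abelian group on which the generators act: coordinates indexed by `ZMod (N b)`,
and two further coordinates for each `b`. -/
abbrev PingPongSpace : Type := ((Σ b : Bool, ZMod (N b)) → ℤ) × (Bool → ℤ) × (Bool → ℤ)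

variable {N}

/-- The action of the `t`-th power of the generator with index `b`. -/
def syllableMap (b : Bool) (t : ℤ) : PingPongSpace N →ₗ[ℤ] PingPongSpace N where
  toFun v :=
    -- The δ terms are coboundaries for the rotation, and 2tp + t²q is a cocycle for p ↦ p + tq;
    -- hence the family is additive in `t`.
    (fun c => if c.1 = b then v.1 ⟨c.1, c.2 - t⟩ else v.1 c + if c.2 = 0 then
        8 * (v.1 ⟨b, 0⟩ - v.1 ⟨b, -t⟩) + 20 * (2 * t * v.2.1 c.1 + t ^ 2 * v.2.2 c.1) else 0,
      fun c => if c = b then v.2.1 c else v.2.1 c + t * v.2.2 c,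
      fun c => if c = b then v.2.2 c + (v.1 ⟨b, 0⟩ - v.1 ⟨b, -t⟩) else v.2.2 c)
  map_add' v w := by
    ext c <;> simp only [Pi.add_apply, Prod.fst_add, Prod.snd_add] <;> split_ifs <;> ring
  map_smul' r v := by
    ext c <;> simp only [Pi.smul_apply, Prod.smul_fst, Prod.smul_snd, smul_eq_mul,
      RingHom.id_apply] <;> split_ifs <;> ring

section Coordinates

variable (b : Bool) (t : ℤ) (v : PingPongSpace N)

theorem syllableMap_fst_self (k : ZMod (N b)) :
    (syllableMap b t v).1 ⟨b, k⟩ = v.1 ⟨b, k - t⟩ := by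
  simp [syllableMap]

theorem syllableMap_fst_zero : (syllableMap b t v).1 ⟨!b, 0⟩ = v.1 ⟨!b, 0⟩ +
    (8 * (v.1 ⟨b, 0⟩ - v.1 ⟨b, -t⟩) + 20 * (2 * t * v.2.1 (!b) + t ^ 2 * v.2.2 (!b))) := by
  simp [syllableMap]

theorem syllableMap_fst_of_ne {k : ZMod (N !b)} (hk : k ≠ 0) :
    (syllableMap b t v).1 ⟨!b, k⟩ = v.1 ⟨!b, k⟩ := by
  simp [syllableMap, hk]

theorem syllableMap_snd_fst_self : (syllableMap b t v).2.1 b = v.2.1 b := by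
  simp [syllableMap]

theorem syllableMap_snd_fst_not :
    (syllableMap b t v).2.1 (!b) = v.2.1 (!b) + t * v.2.2 (!b) := by
  simp [syllableMap]

theorem syllableMap_snd_snd_self :
    (syllableMap b t v).2.2 b = v.2.2 b + (v.1 ⟨b, 0⟩ - v.1 ⟨b, -t⟩) := by
  simp [syllableMap]

theorem syllableMap_snd_snd_not : (syllableMap b t v).2.2 (!b) = v.2.2 (!b) := by
  simp [syllableMap]

end Coordinates

theorem pingPongSpace_ext (b : Bool) {v w : PingPongSpace N}
    (h₁ : ∀ k, v.1 ⟨b, k⟩ = w.1 ⟨b, k⟩) (h₂ : v.1 ⟨!b, 0⟩ = w.1 ⟨!b, 0⟩)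
    (h₃ : ∀ k, k ≠ 0 → v.1 ⟨!b, k⟩ = w.1 ⟨!b, k⟩)
    (h₄ : v.2.1 b = w.2.1 b) (h₅ : v.2.1 (!b) = w.2.1 (!b))
    (h₆ : v.2.2 b = w.2.2 b) (h₇ : v.2.2 (!b) = w.2.2 (!b)) : v = w := by
  have h : ∀ k, v.1 ⟨!b, k⟩ = w.1 ⟨!b, k⟩ := fun k => by
    by_cases hk : k = 0
    · rw [hk, h₂]
    · exact h₃ k hk
  refine Prod.ext (funext ?_) (Prod.ext (funext ?_) (funext ?_))
  · rintro ⟨c, k⟩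
    obtain rfl | rfl : c = b ∨ c = !b := by cases b <;> cases c <;> simp
    exacts [h₁ k, h k]
  all_goals
    intro c
    obtain rfl | rfl : c = b ∨ c = !b := by cases b <;> cases c <;> simp
    all_goals assumption

theorem syllableMap_zero (b : Bool) : syllableMap (N := N) b 0 = LinearMap.id := by
  refine LinearMap.ext fun v => pingPongSpace_ext b ?_ ?_ ?_ ?_ ?_ ?_ ?_ <;>
    simp +contextual [syllableMap]

theorem syllableMap_add (b : Bool) (i j : ℤ) :
    syllableMap (N := N) b (i + j) = syllableMap b i ∘ₗ syllableMap b j := by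
  have h : -((i + j : ℤ) : ZMod (N b)) = -i - j := by push_cast; ring
  refine LinearMap.ext fun v => pingPongSpace_ext b ?_ ?_ ?_ ?_ ?_ ?_ ?_
  · intro k
    simp only [LinearMap.comp_apply, syllableMap_fst_self]
    rw [Int.cast_add, sub_add_eq_sub_sub]
  · simp only [LinearMap.comp_apply, syllableMap_fst_zero, syllableMap_fst_self,
      syllableMap_snd_fst_not, syllableMap_snd_snd_not, h, zero_sub]
    ring
  · intro k hk
    simp only [LinearMap.comp_apply, syllableMap_fst_of_ne _ _ _ hk]
  · simp only [LinearMap.comp_apply, syllableMap_snd_fst_self]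
  · simp only [LinearMap.comp_apply, syllableMap_snd_fst_not, syllableMap_snd_snd_not]
    ring
  · simp only [LinearMap.comp_apply, syllableMap_snd_snd_self, syllableMap_fst_self, h, zero_sub]
    ring
  · simp only [LinearMap.comp_apply, syllableMap_snd_snd_not]

/-- With these exponents the δ terms vanish, so each map reads and changes only the block of the
other generator. -/
theorem syllableMap_comm (k l : ℤ) (v : PingPongSpace N) :
    syllableMap true (N true * k) (syllableMap false (N false * l) v) =
      syllableMap false (N false * l) (syllableMap true (N true * k) v) := by
  refine Prod.ext (funext ?_) (Prod.ext (funext ?_) (funext ?_))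
  · rintro ⟨_ | _, k⟩ <;> simp [syllableMap]
  · rintro (_ | _) <;> simp [syllableMap]
  · rintro (_ | _) <;> simp [syllableMap]

/-! ### Dominance and the ping-pong sets. -/

/-- Coordinate `⟨c, 0⟩` dominates the coordinates `⟨c, j⟩`. -/
def WeaklyDominant (c : Bool) (v : PingPongSpace N) : Prop :=
  0 < v.2.2 c ∧ ∀ j, j ≠ 0 → 4 * (v.2.2 c + |v.2.1 c|) ≤ v.1 ⟨c, 0⟩ - v.1 ⟨c, j⟩

/-- Coordinate `⟨c, 0⟩` dominates the coordinates `⟨c, j⟩`, also after the action of powers of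
the other generator that are multiples of `N (!c)`. -/
def StronglyDominant (c : Bool) (v : PingPongSpace N) : Prop :=
  0 < v.2.2 c ∧ ∀ j, j ≠ 0 → ∀ t : ℤ, 4 * (v.2.2 c + |v.2.1 c + t * v.2.2 c|) + v.2.2 (!c) ≤
    v.1 ⟨c, 0⟩ + 20 * (2 * t * v.2.1 c + t ^ 2 * v.2.2 c) - v.1 ⟨c, j⟩

/-- The set containing the images of the base point under reduced words starting with `b`. -/
def pingPongSet (b : Bool) : Set (PingPongSpace N) :=
  {v | 0 < v.2.2 b ∧ 4 * |v.2.1 b| ≤ v.2.2 b ∧ (∀ k, v.1 ⟨b, k⟩ - v.1 ⟨b, 0⟩ ≤ v.2.2 b) ∧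
    StronglyDominant (!b) v}

/-- The base point of the ping-pong argument. -/
def pingPongBase : PingPongSpace N :=
  -- 100 is ample for dominance. Since 3 does not divide 1, no translate p + 3t with p = 0 equals 1,
  -- which keeps this point away from the ping-pong sets.
  (fun c => if c.2 = 0 then 100 else 0, fun _ => 1, fun _ => 3)

theorem StronglyDominant.weaklyDominant {c : Bool} {v : PingPongSpace N}
    (h : StronglyDominant c v) (h' : 0 ≤ v.2.2 (!c)) : WeaklyDominant c v := by
  refine ⟨h.1, fun j hj => ?_⟩
  have := h.2 j hj 0
  simp only [zero_mul, add_zero, mul_zero, ne_eq, OfNat.ofNat_ne_zero, not_false_eq_true,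
    zero_pow] at this
  linarith

theorem stronglyDominant_pingPongBase (c : Bool) :
    StronglyDominant c (pingPongBase (N := N)) := by
  refine ⟨by simp [pingPongBase], fun j hj t => ?_⟩
  simp only [pingPongBase, if_neg hj, if_true]
  rcases abs_cases (1 + t * 3) with ⟨h, _⟩ | ⟨h, _⟩ <;> rw [h] <;> nlinarith [sq_nonneg (t + 1)]

theorem syllableMap_mul_fst_self (b : Bool) (k : ℤ) (v : PingPongSpace N) (j : ZMod (N b)) :
    (syllableMap b (N b * k) v).1 ⟨b, j⟩ = v.1 ⟨b, j⟩ := by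
  simp [syllableMap]

theorem syllableMap_mul_fst_zero (b : Bool) (k : ℤ) (v : PingPongSpace N) :
    (syllableMap b (N b * k) v).1 ⟨!b, 0⟩ = v.1 ⟨!b, 0⟩ +
      20 * (2 * (N b * k) * v.2.1 (!b) + (N b * k) ^ 2 * v.2.2 (!b)) := by
  simp [syllableMap]

theorem syllableMap_mul_snd_snd (b : Bool) (k : ℤ) (v : PingPongSpace N) (c : Bool) :
    (syllableMap b (N b * k) v).2.2 c = v.2.2 c := by
  simp [syllableMap]

theorem StronglyDominant.syllableMap_mul {b : Bool} {v : PingPongSpace N}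
    (h : StronglyDominant b v) (k : ℤ) : StronglyDominant b (syllableMap b (N b * k) v) := by
  simpa only [StronglyDominant, syllableMap_mul_fst_self, syllableMap_mul_snd_snd,
    syllableMap_snd_fst_self] using h

/-- The action replaces `t` by `t + N b * k` in the quantified inequality. -/
theorem StronglyDominant.syllableMap_mul_not {b : Bool} {v : PingPongSpace N}
    (h : StronglyDominant (!b) v) (k : ℤ) :
    StronglyDominant (!b) (syllableMap b (N b * k) v) := by
  refine ⟨by simpa only [syllableMap_mul_snd_snd] using h.1, fun j hj t => ?_⟩
  have := h.2 j hj (t + N b * k)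
  simp only [syllableMap_mul_fst_zero, syllableMap_mul_snd_snd, syllableMap_snd_fst_not,
    syllableMap_fst_of_ne _ _ _ hj]
  rw [show v.2.1 (!b) + N b * k * v.2.2 (!b) + t * v.2.2 (!b) =
    v.2.1 (!b) + (t + N b * k) * v.2.2 (!b) by ring]
  linarith

theorem intCast_neg_ne_zero {n : ℕ} {i : ℤ} (hi : ¬ (n : ℤ) ∣ i) : -(i : ZMod n) ≠ 0 := by
  rwa [ne_eq, neg_eq_zero, CharP.intCast_eq_zero_iff (ZMod n) n]

/-- Rests on |t| ≤ t² for integers: the quadratic term beats the linear one once q ≥ 4|p|. -/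
theorem quadratic_bound {q p t : ℤ} (hq : 0 < q) (hp : 4 * |p| ≤ q) :
    10 * (t ^ 2 * q) ≤ 20 * (2 * t * p + t ^ 2 * q) ∧ |p + t * q| ≤ |p| + t ^ 2 * q := by
  have h1 : |t| ≤ t ^ 2 := by
    rw [← Int.natCast_natAbs, ← Int.natAbs_sq]
    exact_mod_cast Nat.le_self_pow two_ne_zero _
  have h2 : |t| * (4 * |p|) ≤ t ^ 2 * q :=
    mul_le_mul h1 hp (by positivity) (by positivity)
  have h3 := neg_abs_le (t * p)
  have h4 := abs_add_le p (t * q)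
  have h5 : |t| * q ≤ t ^ 2 * q := mul_le_mul_of_nonneg_right h1 hq.le
  rw [abs_mul] at h3
  rw [abs_mul t q, abs_of_pos hq] at h4
  constructor <;> linarith

/-- The rotation carries the peak away from 0, and the drop δ at 0 is added to q, so q bounds both
4|p| and every f(k) - f(0). -/
theorem mem_pingPongSet_aux {b : Bool} {i : ℤ} {v : PingPongSpace N} (hi : ¬ (N b : ℤ) ∣ i)
    (hw : WeaklyDominant b v) (hs : StronglyDominant (!b) (syllableMap b i v)) :
    syllableMap b i v ∈ pingPongSet b := by
  have hδ := hw.2 _ (intCast_neg_ne_zero hi)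
  have h0 := hw.1
  have h1 := abs_nonneg (v.2.1 b)
  refine ⟨?_, ?_, fun k => ?_, hs⟩
  · rw [syllableMap_snd_snd_self]
    linarith
  · rw [syllableMap_snd_snd_self, syllableMap_snd_fst_self]
    linarith
  · rw [syllableMap_snd_snd_self, syllableMap_fst_self, syllableMap_fst_self, zero_sub]
    by_cases hk : k - i = 0
    · rw [hk]
      linarith
    · have := hw.2 _ hk
      linarith

theorem syllableMap_mem_of_dominant {b : Bool} {i : ℤ} {v : PingPongSpace N}
    (hi : ¬ (N b : ℤ) ∣ i) (hw : WeaklyDominant b v) (hs : StronglyDominant (!b) v) :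
    syllableMap b i v ∈ pingPongSet b := by
  refine mem_pingPongSet_aux hi hw ⟨by simpa only [syllableMap_snd_snd_not] using hs.1,
    fun j hj t => ?_⟩
  have hδ := hw.2 _ (intCast_neg_ne_zero hi)
  have h0 := hw.1
  have h1 := abs_nonneg (v.2.1 b)
  have := hs.2 j hj (t + i)
  simp only [syllableMap_fst_zero, syllableMap_snd_snd_not, syllableMap_snd_fst_not,
    syllableMap_fst_of_ne _ _ _ hj, Bool.not_not, syllableMap_snd_snd_self] at this ⊢
  rw [show v.2.1 (!b) + i * v.2.2 (!b) + t * v.2.2 (!b) =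
    v.2.1 (!b) + (t + i) * v.2.2 (!b) by ring]
  linarith

theorem syllableMap_mem_of_mem_not {b : Bool} {i : ℤ} {v : PingPongSpace N}
    (hi : ¬ (N b : ℤ) ∣ i) (hv : v ∈ pingPongSet (!b)) : syllableMap b i v ∈ pingPongSet b := by
  obtain ⟨hq, hp, hg, hs⟩ := hv
  rw [Bool.not_not] at hs
  have hw := hs.weaklyDominant hq.le
  refine mem_pingPongSet_aux hi hw ⟨by simpa only [syllableMap_snd_snd_not] using hq,
    fun j hj t => ?_⟩
  have hδ := hw.2 _ (intCast_neg_ne_zero hi)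
  -- The extra summand in strong dominance gives δ ≥ q of the other block, so 8δ outweighs the
  -- possible deficit of f(0) there.
  have hδ' := hs.2 _ (intCast_neg_ne_zero hi) 0
  have h0 := hw.1
  have h1 := abs_nonneg (v.2.1 b)
  have h2 := hg j
  obtain ⟨h3, h4⟩ := quadratic_bound (t := t + i) hq hp
  simp only [syllableMap_fst_zero, syllableMap_snd_snd_not, syllableMap_snd_fst_not,
    syllableMap_fst_of_ne _ _ _ hj, Bool.not_not, syllableMap_snd_snd_self, zero_mul, add_zero,
    mul_zero, ne_eq, OfNat.ofNat_ne_zero, not_false_eq_true, zero_pow] at hδ' ⊢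
  rw [show v.2.1 (!b) + i * v.2.2 (!b) + t * v.2.2 (!b) =
    v.2.1 (!b) + (t + i) * v.2.2 (!b) by ring]
  have h5 : 0 ≤ (t + i) ^ 2 * v.2.2 (!b) := by positivity
  linarith

theorem weaklyDominant_syllableMap_mul {b : Bool} {l : ℤ} {v : PingPongSpace N}
    (hl : (N !b : ℤ) * l ≠ 0) (hv : v ∈ pingPongSet b) :
    WeaklyDominant b (syllableMap (!b) (N (!b) * l) v) := by
  obtain ⟨hq, hp, hg, -⟩ := hv
  -- Substituting `b := !c` avoids transporting coordinates along `!!b = b`.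
  have key : ∀ c, (!c) = b → (N c : ℤ) * l ≠ 0 → WeaklyDominant b (syllableMap c (N c * l) v) := by
    rintro c rfl hl
    refine ⟨by rwa [syllableMap_mul_snd_snd], fun j hj => ?_⟩
    rw [syllableMap_mul_fst_zero, syllableMap_mul_snd_snd, syllableMap_snd_fst_not,
      syllableMap_fst_of_ne _ _ _ hj]
    obtain ⟨h1, h2⟩ := quadratic_bound (t := N c * l) hq hp
    have h3 : v.2.2 (!c) ≤ (N c * l) ^ 2 * v.2.2 (!c) :=
      le_mul_of_one_le_left hq.le (Int.add_one_le_iff.2 (sq_pos_of_ne_zero hl))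
    have h4 := hg j
    linarith
  exact key (!b) (Bool.not_not b) hl

theorem syllableMap_mul_ne_pingPongBase {b : Bool} {l : ℤ} {v : PingPongSpace N}
    (hv : v ∈ pingPongSet b) : syllableMap (!b) (N (!b) * l) v ≠ pingPongBase := by
  intro h
  have key : ∀ c, (!c) = b → syllableMap c (N c * l) v = pingPongBase → False := by
    rintro c rfl h
    have hp := congrArg (fun v => v.2.1 (!c)) h
    have hq := congrArg (fun v => v.2.2 (!c)) h
    simp only [syllableMap_snd_fst_not, syllableMap_snd_snd_not, pingPongBase] at hp hq
    have hv := hv.2.1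
    rw [hq] at hp hv
    grind
  exact key (!b) (Bool.not_not b) h

theorem isLinearOver_of_ne_zero {n m : ℕ} (hn : n ≠ 0) (hm : m ≠ 0) :
    IsLinearOver ℤ (PowerCommutatorGroup n m) := by
  let N : Bool → ℕ := fun b => bif b then n else m
  -- Makes each `ZMod (N b)` finite, so that the lattice has finite rank.
  have : ∀ b, NeZero (N b) := fun b => ⟨by cases b <;> assumption⟩
  let w : Bool → (PingPongSpace N ≃ₗ[ℤ] PingPongSpace N) := fun b =>
    linearEquivOfZ _ (syllableMap_zero b) (syllableMap_add b) (Multiplicative.ofAdd 1)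
  have hpow : ∀ b (i : ℤ) v, (w b ^ i) v = syllableMap b i v := fun b i v =>
    linearEquivOfZ_ofAdd_one_zpow _ _ _ i v
  have hw : Commute (w true ^ n) (w false ^ m) := by
    refine LinearEquiv.ext fun v => ?_
    rw [← zpow_natCast, ← zpow_natCast, LinearEquiv.mul_apply, LinearEquiv.mul_apply, hpow, hpow,
      hpow, hpow]
    simpa [N] using syllableMap_comm (N := N) 1 1 v
  let φ := PowerCommutatorGroup.lift w hw
  have hφ : ∀ b i v, φ (PowerCommutatorGroup.gen n m b ^ i) v = syllableMap b i v := by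
    intro b i v
    rw [map_zpow, PowerCommutatorGroup.lift_gen]
    exact hpow b i v
  refine isLinearOver_of_injective φ (injective_of_pingPong (N := N) φ
    (PowerCommutatorGroup.commute_gen n m) (PowerCommutatorGroup.closure_range_gen n m)
    pingPongSet pingPongBase ?_ ?_ ?_ ?_ ?_)
  · intro b i l hi
    rw [hφ, hφ]
    have h₁ := (stronglyDominant_pingPongBase (N := N) (!b)).syllableMap_mul l
    have h₂ := StronglyDominant.syllableMap_mul_not (b := !b)
      (stronglyDominant_pingPongBase (N := N) (!!b)) l
    rw [Bool.not_not] at h₂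
    exact syllableMap_mem_of_dominant hi (h₂.weaklyDominant h₁.1.le) h₁
  · intro b i v hi hv
    rw [hφ]
    exact syllableMap_mem_of_mem_not hi hv
  · intro b i l v hi hl hv
    rw [hφ, hφ]
    exact syllableMap_mem_of_dominant hi (weaklyDominant_syllableMap_mul hl hv)
      (hv.2.2.2.syllableMap_mul l)
  · intro b l v hv
    rw [hφ]
    exact syllableMap_mul_ne_pingPongBase hv
  · intro k l h
    rw [map_mul, LinearEquiv.mul_apply, hφ, hφ] at h
    have h₁ := congrArg (fun v => v.2.1 true) h
    have h₂ := congrArg (fun v => v.2.1 false) h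
    simpa [syllableMap, pingPongBase] using And.intro h₂ h₁

end Finite

theorem mainTheorem12 (n m : ℕ) : IsLinearOver ℤ (PowerCommutatorGroup n m) := by
  by_cases h : n = 0 ∨ m = 0
  · exact isLinearOver_of_eq_zero h
  · rw [not_or] at h
    exact isLinearOver_of_ne_zero h.1 h.2
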